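/- **Theorem 1 (Impossibility).** Consider the linear system $x(t+1)=Ax(t)+w(t)$, $y(t)=Cx(t)+v(t)+a(t)$, $t\in\mathbb N$, with state $x(t)\in\mathbb R^n$, $p$ sensors and attack $a(t)\in\mathbb R^p$. Here $w(t)\sim\mathcal N(0,\sigma_w^2 I_n)$ and $v(t)\sim\mathcal N(0,\sigma_v^2 I_p)$ are i.i.d. over time ($\sigma_w\ge 0$, $\sigma_v>0$), $x(0)\sim\mathcal N(m_0,P_0)$, and $x(0)$, the process $w$ and the process $v$ are mutually independent. Let $0\le k\le p$. A $k$-adversary attacks a fixed set $\kappa\subseteq\{1,\dots,p\}$ of sensors with $|\kappa|=k$: $a_j(t)=0$ for all $j\notin\kappa$ and all $t$, while for $j\in\kappa$ it observes the true outputs and changes them arbitrarily, subject to causality: its knowledge up to time $t$, which determines $a(t)$, is independent of $\{w(t')\}_{t'>t}$ and, for each $i\notin\kappa$, of $\{v_i(t')\}_{t'>t}$. For $s\subseteq\{1,\dots,p\}$ let $\hat x^\star_s(t)$ be the Kalman filter estimate of $x(t)$ (prediction version, initialized with mean $m_0$ and covariance $P_0$) from the attack-free outputs of the sensors in $s$ at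 times $0,\dots,t-1$. Let $P^\star_s(t)=\mathbb E\big[(x(t)-\hat x^\star_s(t))(x(t)-\hat x^\star_s(t))^T\big]$. Assume that for every $s$ with $|s|=p-k$ the filter has a steady-state error covariance $P^\star_s=\lim_{t\to\infty}P^\star_s(t)$, and let $$s_{\mathrm{worst},p-k}\in\arg\max_{|s|=p-k}\operatorname{tr}(P^\star_s).$$ Then there are a set $\kappa$ of $k$ sensors and an attack sequence $a(t)$ of a $k$-adversary on $\kappa$, under which the outputs of all attacked sensors are zero, with the following property. Let $e(t)=x(t)-\mathbb E[x(t)\mid y(0),\dots,y(t-1)]$ be the error of the oracle MMSE estimator, which knows $\kappa$. Then $$\operatorname{tr}\big(\mathbb E(e(t)e(t)^T)\big)\ \ge\ \operatorname{tr}\big(P^\star_{s_{\mathrm{worst},p-k}}\big)$$ at every time $t$ at which the Kalman filter for $s_{\mathrm{worst},p-k}$ is in steady state, i.e. $P^\star_{s_{\mathrm{worst},p-k}}(t)=P^\star_{s_{\mathrm{worst},p-k}}$. Moreover, whether or not it is ever exactly in steady state, the bound holds asymptotically: $\liminf_{t\to\infty}\operatorname{tr}\big(\mathbb E(e(t)e(t)^T)\big)\ge\operatorname{tr}\big(P^\star_{s_{\mathrm{worst},p-k}}\big)$.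 -/

import Mathlib

open MeasureTheory ProbabilityTheory Filter
open scoped Topology

noncomputable section

/-- Parameters of `x(t+1) = A x(t) + w(t)`, `y(t) = C x(t) + v(t)` with `n` states and `p` sensors:
`w(t) ~ N(0, σw² I)`, `v(t) ~ N(0, σv² I)` and `x(0) ~ N(m₀, P₀)`. -/
structure LinSys (n p : ℕ) where
  A : Matrix (Fin n) (Fin n) ℝ
  C : Matrix (Fin p) (Fin n) ℝ
  σw : ℝ
  σv : ℝ
  m₀ : EuclideanSpace ℝ (Fin n)
  P₀ : Matrix (Fin n) (Fin n) ℝ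

namespace LinSys

variable {n p : ℕ} {Ω : Type*} [mΩ : MeasurableSpace Ω]

/-- `x`, `w`, `v` are the state, process noise and sensor noise of the system `S` on `(Ω, μ)`:
the noises are i.i.d. Gaussian over time, and `x(0)`, the process `w` and the process `v` are
mutually independent. -/
structure IsRealization (S : LinSys n p) (μ : Measure Ω)
    (x w : ℕ → Ω → EuclideanSpace ℝ (Fin n)) (v : ℕ → Ω → EuclideanSpace ℝ (Fin p)) : Prop where
  measurable_init : Measurable (x 0)
  measurable_w : ∀ t, Measurable (w t)
  measurable_v : ∀ t, Measurable (v t)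
  law_init : HasLaw (x 0) (multivariateGaussian S.m₀ S.P₀) μ
  law_w : ∀ t, HasLaw (w t) (multivariateGaussian 0 (S.σw ^ 2 • 1)) μ
  law_v : ∀ t, HasLaw (v t) (multivariateGaussian 0 (S.σv ^ 2 • 1)) μ
  indep_w : iIndepFun w μ
  indep_v : iIndepFun v μ
  indep_wv : IndepFun (fun ω t => w t ω) (fun ω t => v t ω) μ
  indep_init : IndepFun (x 0) (fun ω => ((fun t => w t ω), (fun t => v t ω))) μ
  dynamics : ∀ t ω, x (t + 1) ω = S.A.toEuclideanLin (x t ω) + w t ω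

/-- The attack-free output `C x(t) + v(t)`. -/
def cleanOutput (S : LinSys n p) (x : ℕ → Ω → EuclideanSpace ℝ (Fin n))
    (v : ℕ → Ω → EuclideanSpace ℝ (Fin p)) (t : ℕ) (ω : Ω) : EuclideanSpace ℝ (Fin p) :=
  S.C.toEuclideanLin (x t ω) + v t ω

/-- The output `y(t) = C x(t) + v(t) + a(t)` under the attack `a`. -/
def output (S : LinSys n p) (x : ℕ → Ω → EuclideanSpace ℝ (Fin n))
    (v a : ℕ → Ω → EuclideanSpace ℝ (Fin p)) (t : ℕ) (ω : Ω) : EuclideanSpace ℝ (Fin p) :=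
  S.cleanOutput x v t ω + a t ω

/-- `a` is an attack by a `k`-adversary on the (time-independent) sensor set `κ`. The filtration
`𝒦` is the adversary's knowledge: it contains the true outputs of the attacked sensors, determines
the attack, and at time `t` is independent of the process noise after `t` and, for each sensor
outside `κ`, of its noise after `t`. -/
structure IsKAttack (S : LinSys n p) (μ : Measure Ω)
    (x w : ℕ → Ω → EuclideanSpace ℝ (Fin n)) (v : ℕ → Ω → EuclideanSpace ℝ (Fin p))
    (k : ℕ) (κ : Finset (Fin p)) (a : ℕ → Ω → EuclideanSpace ℝ (Fin p)) : Prop where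
  card_eq : κ.card = k
  attack_free : ∀ j ∉ κ, ∀ t ω, a t ω j = 0
  causal : ∃ 𝒦 : Filtration ℕ mΩ,
    (∀ t, Measurable[𝒦 t] (a t)) ∧
    (∀ j ∈ κ, ∀ t, Measurable[𝒦 t] (fun ω => S.cleanOutput x v t ω j)) ∧
    (∀ t, Indep (𝒦 t) (⨆ t' > t, MeasurableSpace.comap (w t') inferInstance) μ) ∧
    (∀ i ∉ κ, ∀ t,
      Indep (𝒦 t) (⨆ t' > t, MeasurableSpace.comap (fun ω => v t' ω i) inferInstance) μ)

/-- The rows of `C` indexed by `s`. -/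
def rows (S : LinSys n p) (s : Finset (Fin p)) : Matrix s (Fin n) ℝ :=
  S.C.submatrix (fun i => (i : Fin p)) id

/-- The Kalman (prediction) gain for the sensors `s` at prediction error covariance `P`. -/
def gain (S : LinSys n p) (s : Finset (Fin p)) (P : Matrix (Fin n) (Fin n) ℝ) :
    Matrix (Fin n) s ℝ :=
  S.A * P * (S.rows s).transpose *
    (S.rows s * P * (S.rows s).transpose + S.σv ^ 2 • (1 : Matrix s s ℝ))⁻¹

/-- The Riccati recursion of the prediction Kalman filter for the sensors `s`. -/
def riccati (S : LinSys n p) (s : Finset (Fin p)) : ℕ → Matrix (Fin n) (Fin n) ℝ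
  | 0 => S.P₀
  | t + 1 =>
    S.A * riccati S s t * S.A.transpose + S.σw ^ 2 • (1 : Matrix (Fin n) (Fin n) ℝ)
      - S.gain s (riccati S s t) * S.rows s * riccati S s t * S.A.transpose

/-- The Kalman filter (prediction version): the estimate at time `t` uses the outputs
`y(0), …, y(t-1)` of the sensors in `s`. -/
def kalman (S : LinSys n p) (s : Finset (Fin p)) (y : ℕ → Ω → EuclideanSpace ℝ (Fin p)) :
    ℕ → Ω → EuclideanSpace ℝ (Fin n)
  | 0, _ => S.m₀
  | t + 1, ω =>
    S.A.toEuclideanLin (kalman S s y t ω) +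
      (S.gain s (S.riccati s t)).toEuclideanLin
        (WithLp.toLp 2 (fun i : s => y t ω i) - (S.rows s).toEuclideanLin (kalman S s y t ω))

/-- The error covariance matrix `E (e eᵀ)`, `e = z - ẑ`, of the estimate `ẑ` of `z`. -/
def errCov (μ : Measure Ω) (z zhat : Ω → EuclideanSpace ℝ (Fin n)) :
    Matrix (Fin n) (Fin n) ℝ :=
  Matrix.of fun i j => ∫ ω, (z ω i - zhat ω i) * (z ω j - zhat ω j) ∂μ

/-- The error covariance at time `t` of the Kalman filter for `s` run on attack-free outputs. -/
def kalmanCov (S : LinSys n p) (μ : Measure Ω) (x : ℕ → Ω → EuclideanSpace ℝ (Fin n))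
    (v : ℕ → Ω → EuclideanSpace ℝ (Fin p)) (s : Finset (Fin p)) (t : ℕ) :
    Matrix (Fin n) (Fin n) ℝ :=
  errCov μ (x t) (S.kalman s (S.cleanOutput x v) t)

/-- `P` is the steady-state error covariance of the attack-free Kalman filter for `s`.
A filter whose error covariance is `P` at all times is a special case. -/
def IsSteadyStateCov (S : LinSys n p) (μ : Measure Ω) (x : ℕ → Ω → EuclideanSpace ℝ (Fin n))
    (v : ℕ → Ω → EuclideanSpace ℝ (Fin p)) (s : Finset (Fin p))
    (P : Matrix (Fin n) (Fin n) ℝ) : Prop :=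
  Tendsto (fun t => S.kalmanCov μ x v s t) atTop (𝓝 P)

/-- The oracle MMSE (prediction) estimate: the conditional expectation of `x(t)` given all
outputs `y(0), …, y(t-1)`. The attacked set and the attack are fixed in advance and enter
through the joint law of `x` and `y`, so the estimator has full knowledge of them. -/
def oracle (μ : Measure Ω) (x : ℕ → Ω → EuclideanSpace ℝ (Fin n))
    (y : ℕ → Ω → EuclideanSpace ℝ (Fin p)) (t : ℕ) : Ω → EuclideanSpace ℝ (Fin n) :=
  condExp (⨆ t' < t, MeasurableSpace.comap (y t') inferInstance) μ (x t)

end LinSys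

end

-- The adversary attacks the complement of the worst set `s` of `p - k` sensors and cancels its
-- outputs. Zero outputs carry no information, so the oracle knows exactly what the attack-free
-- sensors in `s` reveal. In the linear Gaussian model the Kalman filter for `s` is the conditional
-- expectation given that information. Hence the oracle error covariance equals `kalmanCov` for `s`
-- at every time (`errCov_oracle_zeroingAttack`), and both bounds follow from this equality.
--
-- The substance is the optimality of the filter, proved by induction on time as `isOptimalAt`: the
-- prediction error is centered Gaussian, has the Riccati covariance, and is independent of the past
-- outputs. In the inductive step the gain makes the new error uncorrelated with the innovation,
-- joint Gaussianity turns this into independence (`indepFun_of_crossCov_eq_zero`), and the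
-- innovation is all that a new output adds to the old ones (`observed_succ_le`).

-- Independence of σ-algebras

section Independence

variable {Ω : Type*} [mΩ : MeasurableSpace Ω] {μ : Measure Ω}

/-- If `m₁` is independent of `m₂` and `m₁ ⊔ m₂` is independent of `m₃`, then `m₁` is independent
of `m₂ ⊔ m₃`. -/
theorem ProbabilityTheory.Indep.sup_right_of_sup_left [IsProbabilityMeasure μ]
    {m₁ m₂ m₃ : MeasurableSpace Ω}
    (h₁ : m₁ ≤ mΩ) (h₂ : m₂ ≤ mΩ) (h₃ : m₃ ≤ mΩ)
    (h₁₂ : Indep m₁ m₂ μ) (h : Indep (m₁ ⊔ m₂) m₃ μ) : Indep m₁ (m₂ ⊔ m₃) μ := by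
  -- The intersections `b ∩ c` form a π-system generating `m₂ ⊔ m₃`, so the product formula need
  -- only be checked on them.
  have hgen : m₂ ⊔ m₃ = MeasurableSpace.generateFrom
      {s | ∃ b c, MeasurableSet[m₂] b ∧ MeasurableSet[m₃] c ∧ b ∩ c = s} := by
    refine le_antisymm (sup_le (fun b hb => ?_) (fun c hc => ?_))
      (MeasurableSpace.generateFrom_le ?_)
    · exact MeasurableSpace.measurableSet_generateFrom
        ⟨b, Set.univ, hb, MeasurableSet.univ, Set.inter_univ b⟩
    · exact MeasurableSpace.measurableSet_generateFrom
        ⟨Set.univ, c, MeasurableSet.univ, hc, Set.univ_inter c⟩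
    · rintro _ ⟨b, c, hb, hc, rfl⟩
      exact MeasurableSet.inter ((le_sup_left : m₂ ≤ m₂ ⊔ m₃) b hb)
        ((le_sup_right : m₃ ≤ m₂ ⊔ m₃) c hc)
  refine IndepSets.indep h₁ (sup_le h₂ h₃) (@MeasurableSpace.isPiSystem_measurableSet Ω m₁) ?_
    (@MeasurableSpace.generateFrom_measurableSet Ω m₁).symm hgen ?_
  · rintro _ ⟨b, c, hb, hc, rfl⟩ _ ⟨b', c', hb', hc', rfl⟩ -
    exact ⟨b ∩ b', c ∩ c', hb.inter hb', hc.inter hc', Set.inter_inter_inter_comm _ _ _ _⟩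
  · rw [IndepSets_iff]
    rintro a _ ha ⟨b, c, hb, hc, rfl⟩
    have hle₁ : m₁ ≤ m₁ ⊔ m₂ := le_sup_left
    have hle₂ : m₂ ≤ m₁ ⊔ m₂ := le_sup_right
    rw [Indep_iff] at h₁₂ h
    rw [← Set.inter_assoc, h _ _ ((hle₁ a ha).inter (hle₂ b hb)) hc, h₁₂ a b ha hb,
      h b c (hle₂ b hb) hc, mul_assoc]

/-- If the process `X` has independent terms, is independent of the process `Y`, and both are
independent of `Z`, then `X` from time `t` on is independent of `X` before `t`, all of `Y`,
and `Z`. -/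
theorem indep_future [IsProbabilityMeasure μ] {E F G : Type*} [MeasurableSpace E]
    [MeasurableSpace F] [MeasurableSpace G] {X : ℕ → Ω → E} {Y : ℕ → Ω → F} {Z : Ω → G}
    (hX : ∀ i, Measurable (X i)) (hY : ∀ i, Measurable (Y i)) (hZ : Measurable Z)
    (hXind : iIndepFun X μ) (hXY : IndepFun (fun ω i => X i ω) (fun ω i => Y i ω) μ)
    (hXYZ : IndepFun Z (fun ω => ((fun i => X i ω), fun i => Y i ω)) μ) (t : ℕ) :
    Indep (((⨆ i < t, MeasurableSpace.comap (X i) inferInstance) ⊔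
        ⨆ i, MeasurableSpace.comap (Y i) inferInstance) ⊔ MeasurableSpace.comap Z inferInstance)
      (⨆ i ≥ t, MeasurableSpace.comap (X i) inferInstance) μ := by
  have hXle (P : ℕ → Prop) : ⨆ i, ⨆ _ : P i, MeasurableSpace.comap (X i) inferInstance ≤
      MeasurableSpace.comap (fun ω i => X i ω) inferInstance :=
    iSup₂_le fun i _ => measurable_iff_comap_le.mp
      ((measurable_pi_apply i).comp (comap_measurable fun ω i => X i ω))
  have hYle : ⨆ i, MeasurableSpace.comap (Y i) inferInstance ≤
      MeasurableSpace.comap (fun ω i => Y i ω) inferInstance :=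
    iSup_le fun i => measurable_iff_comap_le.mp
      ((measurable_pi_apply i).comp (comap_measurable fun ω i => Y i ω))
  have hXm := (measurable_pi_lambda (fun ω i => X i ω) hX).comap_le
  have hYm := (measurable_pi_lambda (fun ω i => Y i ω) hY).comap_le
  -- The future of `X` is kept on the left while its past, then `Y`, then `Z` are adjoined on the
  -- right by `sup_right_of_sup_left`.
  have h₁ : Indep (⨆ i ≥ t, MeasurableSpace.comap (X i) inferInstance)
      (⨆ i < t, MeasurableSpace.comap (X i) inferInstance) μ :=
    indep_iSup_of_disjoint (S := {i | t ≤ i}) (T := {i | i < t})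
      (fun i => (hX i).comap_le) hXind
      (Set.disjoint_left.mpr fun i (hi : t ≤ i) hi' => hi.not_gt hi')
  have h₂ := h₁.sup_right_of_sup_left ((hXle _).trans hXm) ((hXle _).trans hXm) (hYle.trans hYm)
    (indep_of_indep_of_le_left (indep_of_indep_of_le_right hXY hYle)
      (sup_le (hXle _) (hXle _)))
  have hpair : MeasurableSpace.comap (fun ω => ((fun i => X i ω), fun i => Y i ω)) inferInstance =
      MeasurableSpace.comap (fun ω i => X i ω) inferInstance ⊔
        MeasurableSpace.comap (fun ω i => Y i ω) inferInstance :=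
    MeasurableSpace.comap_prodMk _ _
  refine (h₂.sup_right_of_sup_left ((hXle _).trans hXm)
    (sup_le ((hXle _).trans hXm) (hYle.trans hYm)) hZ.comap_le
    (indep_of_indep_of_le_left hXYZ.symm ?_)).symm
  rw [hpair]
  exact sup_le ((hXle _).trans le_sup_left) (sup_le_sup (hXle _) hYle)

end Independence

-- Cross-covariance matrices

section CrossCovariance

variable {Ω : Type*} [mΩ : MeasurableSpace Ω] {μ : Measure Ω} {ι κ ν : Type*}

/-- The cross-covariance matrix of two random vectors. -/
noncomputable def crossCov (μ : Measure Ω) (X : Ω → EuclideanSpace ℝ ι)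
    (Y : Ω → EuclideanSpace ℝ κ) : Matrix ι κ ℝ :=
  Matrix.of fun i j => cov[fun ω => X ω i, fun ω => Y ω j; μ]

theorem crossCov_transpose (X : Ω → EuclideanSpace ℝ ι) (Y : Ω → EuclideanSpace ℝ κ) :
    (crossCov μ X Y).transpose = crossCov μ Y X := by
  ext i j
  exact covariance_comm _ _

variable [Fintype ι] [Fintype κ]

theorem MeasureTheory.MemLp.euclidean_eval {X : Ω → EuclideanSpace ℝ ι} (hX : MemLp X 2 μ) (i : ι) :
    MemLp (fun ω => X ω i) 2 μ :=
  (EuclideanSpace.proj (𝕜 := ℝ) i).comp_memLp' hX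

theorem memLp_toEuclideanLin [Fintype ν] [DecidableEq ι] (M : Matrix ν ι ℝ)
    {X : Ω → EuclideanSpace ℝ ι} (hX : MemLp X 2 μ) : MemLp (fun ω => M.toEuclideanLin (X ω)) 2 μ :=
  (LinearMap.toContinuousLinearMap M.toEuclideanLin).comp_memLp' hX

theorem crossCov_eq_of_hasLaw_multivariateGaussian [DecidableEq ι] {X : Ω → EuclideanSpace ℝ ι}
    {m : EuclideanSpace ℝ ι} {P : Matrix ι ι ℝ} (hP : P.PosSemidef)
    (hX : HasLaw X (multivariateGaussian m P) μ) : crossCov μ X X = P := by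
  ext i j
  rw [← covariance_eval_multivariateGaussian (μ := m) hP i j, ← hX.map_eq,
    covariance_map (by fun_prop) (by fun_prop) hX.aemeasurable]
  rfl

theorem crossCov_eq_zero_of_indepFun {X : Ω → EuclideanSpace ℝ ι} {Y : Ω → EuclideanSpace ℝ κ}
    (hX : MemLp X 2 μ) (hY : MemLp Y 2 μ) (h : IndepFun X Y μ) : crossCov μ X Y = 0 := by
  ext i j
  have hij : IndepFun (fun ω => X ω i) (fun ω => Y ω j) μ :=
    h.comp (φ := fun x : EuclideanSpace ℝ ι => x i) (ψ := fun y : EuclideanSpace ℝ κ => y j)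
      (by fun_prop) (by fun_prop)
  exact hij.covariance_eq_zero (hX.euclidean_eval i) (hY.euclidean_eval j)

variable [IsProbabilityMeasure μ]

theorem crossCov_add_left {X Y : Ω → EuclideanSpace ℝ ι} {Z : Ω → EuclideanSpace ℝ κ}
    (hX : MemLp X 2 μ) (hY : MemLp Y 2 μ) (hZ : MemLp Z 2 μ) :
    crossCov μ (fun ω => X ω + Y ω) Z = crossCov μ X Z + crossCov μ Y Z := by
  ext i j
  exact covariance_add_left (hX.euclidean_eval i) (hY.euclidean_eval i) (hZ.euclidean_eval j)

theorem crossCov_sub_left {X Y : Ω → EuclideanSpace ℝ ι} {Z : Ω → EuclideanSpace ℝ κ}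
    (hX : MemLp X 2 μ) (hY : MemLp Y 2 μ) (hZ : MemLp Z 2 μ) :
    crossCov μ (fun ω => X ω - Y ω) Z = crossCov μ X Z - crossCov μ Y Z := by
  ext i j
  exact covariance_sub_left (hX.euclidean_eval i) (hY.euclidean_eval i) (hZ.euclidean_eval j)

theorem crossCov_add_right {X : Ω → EuclideanSpace ℝ ι} {Y Z : Ω → EuclideanSpace ℝ κ}
    (hX : MemLp X 2 μ) (hY : MemLp Y 2 μ) (hZ : MemLp Z 2 μ) :
    crossCov μ X (fun ω => Y ω + Z ω) = crossCov μ X Y + crossCov μ X Z := by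
  ext i j
  exact covariance_add_right (hX.euclidean_eval i) (hY.euclidean_eval j) (hZ.euclidean_eval j)

theorem crossCov_sub_right {X : Ω → EuclideanSpace ℝ ι} {Y Z : Ω → EuclideanSpace ℝ κ}
    (hX : MemLp X 2 μ) (hY : MemLp Y 2 μ) (hZ : MemLp Z 2 μ) :
    crossCov μ X (fun ω => Y ω - Z ω) = crossCov μ X Y - crossCov μ X Z := by
  ext i j
  exact covariance_sub_right (hX.euclidean_eval i) (hY.euclidean_eval j) (hZ.euclidean_eval j)

theorem crossCov_toEuclideanLin_left [DecidableEq ι] (M : Matrix ν ι ℝ)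
    {X : Ω → EuclideanSpace ℝ ι} {Y : Ω → EuclideanSpace ℝ κ}
    (hX : MemLp X 2 μ) (hY : MemLp Y 2 μ) :
    crossCov μ (fun ω => M.toEuclideanLin (X ω)) Y = M * crossCov μ X Y := by
  ext i j
  have h : (fun ω => M.toEuclideanLin (X ω) i) = fun ω => ∑ l, M i l * X ω l := by
    ext ω
    simp [Matrix.toLpLin_apply, Matrix.mulVec, dotProduct]
  simp only [crossCov, Matrix.of_apply, Matrix.mul_apply, h]
  rw [covariance_fun_sum_left (fun l => (hX.euclidean_eval l).const_mul _) (hY.euclidean_eval j)]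
  simp only [covariance_const_mul_left]

theorem crossCov_toEuclideanLin_right [DecidableEq κ] (M : Matrix ν κ ℝ)
    {X : Ω → EuclideanSpace ℝ ι} {Y : Ω → EuclideanSpace ℝ κ}
    (hX : MemLp X 2 μ) (hY : MemLp Y 2 μ) :
    crossCov μ X (fun ω => M.toEuclideanLin (Y ω)) = crossCov μ X Y * M.transpose := by
  rw [← crossCov_transpose, crossCov_toEuclideanLin_left M hY hX, Matrix.transpose_mul,
    crossCov_transpose]

theorem crossCov_self_posSemidef {X : Ω → EuclideanSpace ℝ ι} (hX : MemLp X 2 μ) :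
    (crossCov μ X X).PosSemidef := by
  classical
  refine Matrix.PosSemidef.of_dotProduct_mulVec_nonneg ?_ fun y => ?_
  · rw [Matrix.IsHermitian, Matrix.conjTranspose_eq_transpose_of_trivial, crossCov_transpose]
  -- The quadratic form at `y` is the variance of the scalar `⟨y, X⟩`, written here as a one-row
  -- matrix applied to `X`.
  · let M : Matrix Unit ι ℝ := Matrix.replicateRow Unit y
    have h : 0 ≤ crossCov μ (fun ω => M.toEuclideanLin (X ω)) (fun ω => M.toEuclideanLin (X ω))
        () () := by
      have hm := (memLp_toEuclideanLin M hX).euclidean_eval ()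
      simp only [crossCov, Matrix.of_apply]
      rw [covariance_self hm.aemeasurable]
      exact variance_nonneg _ _
    rw [crossCov_toEuclideanLin_left M hX (memLp_toEuclideanLin M hX),
      crossCov_toEuclideanLin_right M hX hX] at h
    simpa [M, Matrix.mul_apply, Matrix.mulVec, dotProduct] using h

/-- Covariances of linear functionals of `X` and `Y` are combinations of the entries of `crossCov`,
so all vanish; for a jointly Gaussian pair this forces independence. -/
theorem indepFun_of_crossCov_eq_zero {X : Ω → EuclideanSpace ℝ ι} {Y : Ω → EuclideanSpace ℝ κ}
    (hXY : HasGaussianLaw (fun ω => (X ω, Y ω)) μ) (h : crossCov μ X Y = 0) :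
    IndepFun X Y μ := by
  classical
  refine hXY.indepFun_of_covariance_inner fun a b => ?_
  have hX : MemLp X 2 μ := hXY.fst.memLp_two
  have hY : MemLp Y 2 μ := hXY.snd.memLp_two
  simp only [PiLp.inner_apply, RCLike.inner_apply, conj_trivial]
  rw [covariance_fun_sum_fun_sum (fun l => (hX.euclidean_eval l).mul_const _)
    (fun l => (hY.euclidean_eval l).mul_const _)]
  refine Finset.sum_eq_zero fun i _ => Finset.sum_eq_zero fun j _ => ?_
  rw [covariance_mul_const_left, covariance_mul_const_right]
  have := congrFun (congrFun h i) j
  simp only [crossCov, Matrix.of_apply, Matrix.zero_apply] at this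
  rw [this]; simp

end CrossCovariance

theorem measurable_euclidean_of_eval {α ι : Type*} {m : MeasurableSpace α} [Fintype ι]
    {f : α → EuclideanSpace ℝ ι} (hf : ∀ i, Measurable[m] fun a => f a i) : Measurable[m] f :=
  (WithLp.measurable_toLp 2 (ι → ℝ)).comp (measurable_pi_lambda (fun a i => f a i) hf)

theorem Measurable.toEuclideanLin {α ι κ : Type*} {m : MeasurableSpace α} [Fintype ι] [Fintype κ]
    [DecidableEq ι] (M : Matrix κ ι ℝ) {f : α → EuclideanSpace ℝ ι} (hf : Measurable f) :
    Measurable fun a => M.toEuclideanLin (f a) :=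
  (LinearMap.toContinuousLinearMap M.toEuclideanLin).continuous.measurable.comp hf

-- The zeroing attack and the information in its outputs

namespace LinSys

section Observations

variable {n p : ℕ} {Ω : Type*} {S : LinSys n p} {x w : ℕ → Ω → EuclideanSpace ℝ (Fin n)}
  {v : ℕ → Ω → EuclideanSpace ℝ (Fin p)}

/-- The σ-algebra generated by `x(0)` and the noises before time `t`. -/
@[reducible]
def past (x w : ℕ → Ω → EuclideanSpace ℝ (Fin n)) (v : ℕ → Ω → EuclideanSpace ℝ (Fin p)) (t : ℕ) :
    MeasurableSpace Ω :=
  ((⨆ i < t, MeasurableSpace.comap (w i) inferInstance) ⊔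
    (⨆ i < t, MeasurableSpace.comap (v i) inferInstance)) ⊔
    MeasurableSpace.comap (x 0) inferInstance

theorem past_mono : Monotone (past x w v) := fun _ _ h =>
  sup_le_sup_right (sup_le_sup
    (biSup_mono fun _ hi => lt_of_lt_of_le hi h) (biSup_mono fun _ hi => lt_of_lt_of_le hi h)) _

theorem measurable_init_past (t : ℕ) : Measurable[past x w v t] (x 0) :=
  Measurable.of_comap_le le_sup_right

theorem measurable_w_past {i t : ℕ} (h : i < t) : Measurable[past x w v t] (w i) :=
  Measurable.of_comap_le (le_trans (le_iSup₂_of_le i h le_rfl) (le_sup_left.trans le_sup_left))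

theorem measurable_v_past {i t : ℕ} (h : i < t) : Measurable[past x w v t] (v i) :=
  Measurable.of_comap_le (le_trans (le_iSup₂_of_le i h le_rfl) (le_sup_right.trans le_sup_left))

/-- The Kalman prediction error for the sensors `s` on attack-free outputs. -/
noncomputable def predError (S : LinSys n p) (x : ℕ → Ω → EuclideanSpace ℝ (Fin n))
    (v : ℕ → Ω → EuclideanSpace ℝ (Fin p)) (s : Finset (Fin p)) (t : ℕ) (ω : Ω) :
    EuclideanSpace ℝ (Fin n) :=
  x t ω - S.kalman s (S.cleanOutput x v) t ω

/-- The noise of the sensors `s`. -/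
noncomputable def sensorNoise (v : ℕ → Ω → EuclideanSpace ℝ (Fin p)) (s : Finset (Fin p)) (t : ℕ)
    (ω : Ω) : EuclideanSpace ℝ s :=
  WithLp.toLp 2 fun i : s => v t ω i

/-- The innovation of the Kalman filter for the sensors `s`. -/
noncomputable def innovation (S : LinSys n p) (x : ℕ → Ω → EuclideanSpace ℝ (Fin n))
    (v : ℕ → Ω → EuclideanSpace ℝ (Fin p)) (s : Finset (Fin p)) (t : ℕ) (ω : Ω) :
    EuclideanSpace ℝ s :=
  (S.rows s).toEuclideanLin (S.predError x v s t ω) + sensorNoise v s t ω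

/-- The attack on the sensors outside `s` that makes their outputs zero. -/
noncomputable def zeroingAttack (S : LinSys n p) (x : ℕ → Ω → EuclideanSpace ℝ (Fin n))
    (v : ℕ → Ω → EuclideanSpace ℝ (Fin p)) (s : Finset (Fin p)) (t : ℕ) (ω : Ω) :
    EuclideanSpace ℝ (Fin p) :=
  WithLp.toLp 2 fun j => if j ∈ s then 0 else - S.cleanOutput x v t ω j

theorem output_zeroingAttack_of_mem {s : Finset (Fin p)} {j : Fin p} (hj : j ∈ s) (t : ℕ) (ω : Ω) :
    S.output x v (S.zeroingAttack x v s) t ω j = S.cleanOutput x v t ω j := by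
  simp [output, zeroingAttack, hj]

theorem output_zeroingAttack_of_notMem {s : Finset (Fin p)} {j : Fin p} (hj : j ∉ s) (t : ℕ)
    (ω : Ω) : S.output x v (S.zeroingAttack x v s) t ω j = 0 := by
  simp [output, zeroingAttack, hj]

theorem rows_toEuclideanLin_apply (s : Finset (Fin p)) (z : EuclideanSpace ℝ (Fin n)) (i : s) :
    (S.rows s).toEuclideanLin z i = S.C.toEuclideanLin z i := by
  simp [rows, Matrix.toLpLin_apply, Matrix.mulVec, dotProduct]

/-- The correction term in `kalman` depends only on the current prediction error and sensor noise,
which lets the error satisfy a recursion of its own. -/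
theorem cleanOutput_sub_kalman (s : Finset (Fin p)) (t : ℕ) (ω : Ω) :
    WithLp.toLp 2 (fun i : s => S.cleanOutput x v t ω i)
      - (S.rows s).toEuclideanLin (S.kalman s (S.cleanOutput x v) t ω)
      = S.innovation x v s t ω := by
  ext i
  simp only [innovation, predError, sensorNoise, map_sub, PiLp.sub_apply, PiLp.add_apply,
    cleanOutput, rows_toEuclideanLin_apply]
  ring

/-- The σ-algebra generated by the outputs before time `t` under the zeroing attack. -/
@[reducible]
noncomputable def observed (S : LinSys n p) (x : ℕ → Ω → EuclideanSpace ℝ (Fin n))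
    (v : ℕ → Ω → EuclideanSpace ℝ (Fin p)) (s : Finset (Fin p)) (t : ℕ) : MeasurableSpace Ω :=
  ⨆ t' < t, MeasurableSpace.comap (S.output x v (S.zeroingAttack x v s) t') inferInstance

theorem observed_mono (s : Finset (Fin p)) : Monotone (S.observed x v s) := fun _ _ h =>
  biSup_mono fun _ hi => lt_of_lt_of_le hi h

theorem measurable_output_observed (s : Finset (Fin p)) {i t : ℕ} (h : i < t) :
    Measurable[S.observed x v s t] (S.output x v (S.zeroingAttack x v s) i) :=
  Measurable.of_comap_le (le_iSup₂_of_le i h le_rfl)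

/-- The filter for `s` reads only sensors that the attack leaves intact, so its estimate can be
computed from the attacked outputs. -/
theorem measurable_kalman_observed (s : Finset (Fin p)) (t : ℕ) :
    Measurable[S.observed x v s t] (S.kalman s (S.cleanOutput x v) t) := by
  induction t with
  | zero => exact measurable_const
  | succ t ih =>
    have hk : Measurable[S.observed x v s (t + 1)] (S.kalman s (S.cleanOutput x v) t) :=
      ih.mono (observed_mono s t.le_succ) le_rfl
    have hy : Measurable[S.observed x v s (t + 1)] fun ω =>
        WithLp.toLp 2 (fun i : s => S.cleanOutput x v t ω i) := by
      refine measurable_euclidean_of_eval fun i => ?_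
      have h := measurable_output_observed (S := S) (x := x) (v := v) s t.lt_succ_self
      have hi : Measurable[S.observed x v s (t + 1)] fun ω =>
          S.output x v (S.zeroingAttack x v s) t ω i :=
        (by fun_prop : Measurable fun z : EuclideanSpace ℝ (Fin p) => z i).comp h
      simpa only [output_zeroingAttack_of_mem i.2] using hi
    exact (hk.toEuclideanLin S.A).add ((hy.sub (hk.toEuclideanLin _)).toEuclideanLin _)

/-- The past outputs determine the estimate; adding the predicted output to the innovation recovers
the new outputs in `s`, and the remaining outputs are constant. -/
theorem observed_succ_le (s : Finset (Fin p)) (t : ℕ) :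
    S.observed x v s (t + 1) ≤
      MeasurableSpace.comap (S.innovation x v s t) inferInstance ⊔ S.observed x v s t := by
  refine iSup₂_le fun i hi => ?_
  rcases Nat.lt_succ_iff_lt_or_eq.mp hi with hi | rfl
  · exact (le_iSup₂_of_le (f := fun i (_ : i < t) => MeasurableSpace.comap
      (S.output x v (S.zeroingAttack x v s) i) inferInstance) i hi le_rfl).trans le_sup_right
  · rw [← measurable_iff_comap_le]
    set m := MeasurableSpace.comap (S.innovation x v s i) inferInstance ⊔ S.observed x v s i
    have hk : Measurable[m] (S.kalman s (S.cleanOutput x v) i) :=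
      (measurable_kalman_observed s i).mono le_sup_right le_rfl
    have hin : Measurable[m] (S.innovation x v s i) := Measurable.of_comap_le le_sup_left
    refine measurable_euclidean_of_eval fun j => ?_
    by_cases hj : j ∈ s
    · have h : Measurable[m] fun ω => (S.innovation x v s i ω
          + (S.rows s).toEuclideanLin (S.kalman s (S.cleanOutput x v) i ω)) ⟨j, hj⟩ :=
        (by fun_prop : Measurable fun z : EuclideanSpace ℝ s => z ⟨j, hj⟩).comp
          (hin.add (hk.toEuclideanLin _))
      simpa only [← cleanOutput_sub_kalman, sub_add_cancel, output_zeroingAttack_of_mem hj] using h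
    · simp only [output_zeroingAttack_of_notMem hj]
      exact measurable_const

end Observations

-- Causality and admissibility of the attack

variable {n p : ℕ} {Ω : Type*} [mΩ : MeasurableSpace Ω] {S : LinSys n p} {μ : Measure Ω}
  {x w : ℕ → Ω → EuclideanSpace ℝ (Fin n)} {v : ℕ → Ω → EuclideanSpace ℝ (Fin p)}

namespace IsRealization

theorem past_le (hS : S.IsRealization μ x w v) (t : ℕ) : past x w v t ≤ mΩ :=
  sup_le (sup_le (iSup₂_le fun i _ => (hS.measurable_w i).comap_le)
    (iSup₂_le fun i _ => (hS.measurable_v i).comap_le)) hS.measurable_init.comap_le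

theorem measurable_state_past (hS : S.IsRealization μ x w v) (t : ℕ) :
    Measurable[past x w v t] (x t) := by
  induction t with
  | zero => exact measurable_init_past 0
  | succ t ih =>
    have h : x (t + 1) = fun ω => S.A.toEuclideanLin (x t ω) + w t ω := funext (hS.dynamics t)
    rw [h]
    exact ((ih.mono (past_mono t.le_succ) le_rfl).toEuclideanLin S.A).add
      (measurable_w_past t.lt_succ_self)

theorem measurable_cleanOutput_past (hS : S.IsRealization μ x w v) (t : ℕ) :
    Measurable[past x w v (t + 1)] (S.cleanOutput x v t) := by
  exact (((hS.measurable_state_past t).mono (past_mono t.le_succ) le_rfl).toEuclideanLin S.C).add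
    (measurable_v_past t.lt_succ_self)

theorem measurable_zeroingAttack_past (hS : S.IsRealization μ x w v) (s : Finset (Fin p)) (t : ℕ) :
    Measurable[past x w v (t + 1)] (S.zeroingAttack x v s t) := by
  refine measurable_euclidean_of_eval fun j => ?_
  have h : Measurable[past x w v (t + 1)] fun ω => S.cleanOutput x v t ω j :=
    (by fun_prop : Measurable fun z : EuclideanSpace ℝ (Fin p) => z j).comp
      (hS.measurable_cleanOutput_past t)
  by_cases hj : j ∈ s
  · simp only [zeroingAttack, hj, if_true]
    exact measurable_const
  · simp only [zeroingAttack, hj, if_false]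
    exact h.neg

theorem observed_le_past (hS : S.IsRealization μ x w v) (s : Finset (Fin p)) (t : ℕ) :
    S.observed x v s t ≤ past x w v t := by
  refine iSup₂_le fun i hi => ?_
  refine le_trans ?_ (past_mono (Nat.succ_le_of_lt hi))
  rw [← measurable_iff_comap_le]
  exact (hS.measurable_cleanOutput_past i).add (hS.measurable_zeroingAttack_past s i)

theorem measurable_predError_past (hS : S.IsRealization μ x w v) (s : Finset (Fin p)) (t : ℕ) :
    Measurable[past x w v t] (S.predError x v s t) := by
  exact (hS.measurable_state_past t).sub
    ((measurable_kalman_observed s t).mono (hS.observed_le_past s t) le_rfl)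

theorem integrable_state (hS : S.IsRealization μ x w v) (t : ℕ) : Integrable (x t) μ := by
  induction t with
  | zero => exact hS.law_init.hasGaussianLaw.integrable
  | succ t ih =>
    have h : x (t + 1) = fun ω => S.A.toEuclideanLin (x t ω) + w t ω := funext (hS.dynamics t)
    rw [h]
    exact ((LinearMap.toContinuousLinearMap S.A.toEuclideanLin).integrable_comp ih).add
      (hS.law_w t).hasGaussianLaw.integrable

theorem predError_succ (hS : S.IsRealization μ x w v) (s : Finset (Fin p)) (t : ℕ) (ω : Ω) :
    S.predError x v s (t + 1) ω = (S.A.toEuclideanLin (S.predError x v s t ω) + w t ω)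
      - (S.gain s (S.riccati s t)).toEuclideanLin (S.innovation x v s t ω) := by
  rw [predError, hS.dynamics, kalman, cleanOutput_sub_kalman, predError, map_sub]
  abel

variable [IsProbabilityMeasure μ]

/-- The process noise from time `t` on is independent of the past. -/
theorem indep_past_w (hS : S.IsRealization μ x w v) (t : ℕ) :
    Indep (past x w v t) (⨆ i ≥ t, MeasurableSpace.comap (w i) inferInstance) μ :=
  indep_of_indep_of_le_left (indep_future hS.measurable_w hS.measurable_v hS.measurable_init
      hS.indep_w hS.indep_wv hS.indep_init t)
    (sup_le_sup_right (sup_le_sup_left (iSup₂_le_iSup _ _) _) _)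

/-- The sensor noise from time `t` on is independent of the past and of all process noise. -/
theorem indep_past_sup_w_v (hS : S.IsRealization μ x w v) (t : ℕ) :
    Indep (past x w v t ⊔ ⨆ i, MeasurableSpace.comap (w i) inferInstance)
      (⨆ i ≥ t, MeasurableSpace.comap (v i) inferInstance) μ := by
  refine indep_of_indep_of_le_left (indep_future hS.measurable_v hS.measurable_w
    hS.measurable_init hS.indep_v hS.indep_wv.symm
    (hS.indep_init.comp measurable_id measurable_swap) t) (sup_le ?_ ?_)
  · refine sup_le_sup_right ?_ _
    rw [sup_comm]
    exact sup_le_sup_left (iSup₂_le_iSup _ _) _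
  · exact le_sup_right.trans le_sup_left

/-- The attack that zeroes the outputs of the sensors outside `s` is an admissible attack. -/
theorem isKAttack_zeroingAttack (hS : S.IsRealization μ x w v)
    {k : ℕ} (hk : k ≤ p) {s : Finset (Fin p)} (hs : s.card = p - k) :
    S.IsKAttack μ x w v k sᶜ (S.zeroingAttack x v s) where
  card_eq := by
    rw [Finset.card_compl, Fintype.card_fin, hs]
    omega
  attack_free j hj t ω := by
    have : j ∈ s := by simpa using hj
    simp [zeroingAttack, this]
  causal := by
    -- The knowledge at time `t` is `past` at `t + 1`, since the output at `t` involves `v t`; the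
    -- noises with index at least `t + 1` are then exactly the future ones.
    refine ⟨⟨fun t => past x w v (t + 1), fun _ _ h => past_mono (by omega),
      fun t => hS.past_le _⟩, fun t => hS.measurable_zeroingAttack_past s t, fun j _ t => ?_,
      fun t => hS.indep_past_w (t + 1), fun i _ t => ?_⟩
    · exact (by fun_prop : Measurable fun z : EuclideanSpace ℝ (Fin p) => z j).comp
        (hS.measurable_cleanOutput_past t)
    · refine indep_of_indep_of_le_right
        (indep_of_indep_of_le_left (hS.indep_past_sup_w_v (t + 1)) le_sup_left)
        (iSup₂_mono fun t' _ => ?_)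
      exact measurable_iff_comap_le.mp
        ((by fun_prop : Measurable fun z : EuclideanSpace ℝ (Fin p) => z i).comp
          (comap_measurable (v t')))

end IsRealization

end LinSys

-- Optimality of the Kalman filter

namespace LinSys

variable {n p : ℕ} {Ω : Type*} [mΩ : MeasurableSpace Ω] {S : LinSys n p} {μ : Measure Ω}
  {x w : ℕ → Ω → EuclideanSpace ℝ (Fin n)} {v : ℕ → Ω → EuclideanSpace ℝ (Fin p)}

/-- Restriction of a vector to the coordinates in `s`. -/
noncomputable def restrictCLM (s : Finset (Fin p)) :
    EuclideanSpace ℝ (Fin p) →L[ℝ] EuclideanSpace ℝ s :=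
  LinearMap.toContinuousLinearMap
    { toFun := fun z => WithLp.toLp 2 fun i : s => z i
      map_add' := fun _ _ => rfl
      map_smul' := fun _ _ => rfl }

/-- The error of the Kalman filter for `s` at time `t` is a centered Gaussian vector whose
covariance is given by the Riccati recursion, and which is independent of the observations. -/
structure IsOptimalAt (S : LinSys n p) (μ : Measure Ω) (x : ℕ → Ω → EuclideanSpace ℝ (Fin n))
    (v : ℕ → Ω → EuclideanSpace ℝ (Fin p)) (s : Finset (Fin p)) (t : ℕ) : Prop where
  gaussian : HasGaussianLaw (S.predError x v s t) μ
  mean : ∫ ω, S.predError x v s t ω ∂μ = 0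
  cov : crossCov μ (S.predError x v s t) (S.predError x v s t) = S.riccati s t
  indep : Indep (MeasurableSpace.comap (S.predError x v s t) inferInstance) (S.observed x v s t) μ

/-- The σ-algebra generated by the Kalman error for `s` and the noises at time `t`. -/
@[reducible]
noncomputable def errorNoise (S : LinSys n p) (x w : ℕ → Ω → EuclideanSpace ℝ (Fin n))
    (v : ℕ → Ω → EuclideanSpace ℝ (Fin p)) (s : Finset (Fin p)) (t : ℕ) : MeasurableSpace Ω :=
  (MeasurableSpace.comap (S.predError x v s t) inferInstance ⊔
    MeasurableSpace.comap (w t) inferInstance) ⊔ MeasurableSpace.comap (v t) inferInstance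

/-- The Kalman gain solves the normal equations. -/
theorem gain_mul (s : Finset (Fin p)) (hσv : 0 < S.σv) {P : Matrix (Fin n) (Fin n) ℝ}
    (hP : P.PosSemidef) :
    S.gain s P * (S.rows s * P * (S.rows s).transpose + S.σv ^ 2 • (1 : Matrix s s ℝ)) =
      S.A * P * (S.rows s).transpose := by
  have h₁ : (S.rows s * P * (S.rows s).transpose).PosSemidef := by
    simpa [Matrix.conjTranspose_eq_transpose_of_trivial] using
      hP.mul_mul_conjTranspose_same (S.rows s)
  -- Positive sensor noise makes the innovation covariance positive definite, so the inverse in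
  -- `gain` is a genuine one.
  have h₂ : (S.σv ^ 2 • (1 : Matrix s s ℝ)).PosDef := Matrix.PosDef.one.smul (by positivity)
  have hdet := (Matrix.isUnit_iff_isUnit_det _).mp (h₂.posSemidef_add h₁).isUnit
  rw [gain, Matrix.mul_assoc, Matrix.nonsing_inv_mul _ hdet, Matrix.mul_one]

namespace IsRealization

variable [IsProbabilityMeasure μ]

theorem isOptimalAt_zero (hS : S.IsRealization μ x w v)
    (hP₀ : S.P₀.PosSemidef) (s : Finset (Fin p)) :
    S.IsOptimalAt μ x v s 0 := by
  have he : S.predError x v s 0 = fun ω => x 0 ω - S.m₀ := rfl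
  have hg : HasGaussianLaw (x 0) μ := hS.law_init.hasGaussianLaw
  have hint : ∫ ω, x 0 ω ∂μ = S.m₀ := by
    rw [hS.law_init.integral_eq]
    exact integral_id_multivariateGaussian
  refine ⟨?_, ?_, ?_, ?_⟩
  · rw [he]
    have := hg.isGaussian_map
    refine ⟨?_⟩
    have h : μ.map (fun ω => x 0 ω - S.m₀) = (μ.map (x 0)).map (fun z => z - S.m₀) := by
      rw [Measure.map_map (by fun_prop) hS.measurable_init]
      rfl
    rw [h]
    infer_instance
  · simp only [he]
    rw [integral_sub hg.integrable (integrable_const _), hint]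
    simp
  · rw [riccati, ← crossCov_eq_of_hasLaw_multivariateGaussian hP₀ hS.law_init, he]
    ext i j
    have hi (l : Fin n) : Integrable (fun ω => x 0 ω l) μ :=
      (hg.memLp_two.euclidean_eval l).integrable (by norm_num)
    simp only [crossCov, Matrix.of_apply, PiLp.sub_apply]
    rw [covariance_sub_const_left (hi i), covariance_sub_const_right (hi j)]
  · have h : S.observed x v s 0 = ⊥ := by simp [observed]
    rw [h]
    exact indep_bot_right _

/-- The new error and the innovation are linear images of `(e, w t, v t)`, a Gaussian triple with
independent components, jointly independent of the earlier outputs. Everything reduces to second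
moments of this triple. -/
theorem isOptimalAt_succ (hS : S.IsRealization μ x w v)
    (hσv : 0 < S.σv) {s : Finset (Fin p)} {t : ℕ}
    (h : S.IsOptimalAt μ x v s t) : S.IsOptimalAt μ x v s (t + 1) := by
  set e := S.predError x v s t
  set e' := S.predError x v s (t + 1)
  set η := S.innovation x v s t
  set P := S.riccati s t with hP
  set K := S.gain s P with hK
  have heN : Measurable[S.errorNoise x w v s t] e :=
    Measurable.of_comap_le (le_sup_left.trans le_sup_left)
  have hwN : Measurable[S.errorNoise x w v s t] (w t) :=
    Measurable.of_comap_le (le_sup_right.trans le_sup_left)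
  have hvN : Measurable[S.errorNoise x w v s t] (v t) := Measurable.of_comap_le le_sup_right
  have hη_eq : η = fun ω => (S.rows s).toEuclideanLin (e ω) + sensorNoise v s t ω := rfl
  have he'_eq : e' = fun ω => (S.A.toEuclideanLin (e ω) + w t ω) - K.toEuclideanLin (η ω) :=
    funext (hS.predError_succ s t)
  have hηN : Measurable[S.errorNoise x w v s t] η := (heN.toEuclideanLin _).add
    ((restrictCLM s).continuous.measurable.comp hvN)
  have he'N : Measurable[S.errorNoise x w v s t] e' := by
    rw [he'_eq]
    exact ((heN.toEuclideanLin _).add hwN).sub (hηN.toEuclideanLin _)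
  have he_past : MeasurableSpace.comap e inferInstance ≤ past x w v t :=
    (hS.measurable_predError_past s t).comap_le
  have hpast := hS.past_le t
  have hY_past := hS.observed_le_past s t
  have hwle := (hS.measurable_w t).comap_le
  have hvle := (hS.measurable_v t).comap_le
  -- independence of the error, the noises at time `t` and the observations
  have hpast_w : Indep (past x w v t) (MeasurableSpace.comap (w t) inferInstance) μ :=
    indep_of_indep_of_le_right (hS.indep_past_w t) (le_iSup₂_of_le t le_rfl le_rfl)
  have hpast_v : Indep (past x w v t ⊔ MeasurableSpace.comap (w t) inferInstance)
      (MeasurableSpace.comap (v t) inferInstance) μ :=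
    indep_of_indep_of_le_left (indep_of_indep_of_le_right (hS.indep_past_sup_w_v t)
      (le_iSup₂_of_le t le_rfl le_rfl))
        (sup_le_sup_left (le_iSup (fun i => MeasurableSpace.comap (w i) inferInstance) t) _)
  have hew : IndepFun e (w t) μ := indep_of_indep_of_le_left hpast_w he_past
  have hewv : IndepFun (fun ω => (e ω, w t ω)) (v t) μ := by
    refine indep_of_indep_of_le_left hpast_v ?_
    exact (MeasurableSpace.comap_prodMk e (w t)).trans_le (sup_le_sup_right he_past _)
  -- Independence from `e` is the induction hypothesis; `w t` and `v t` are adjoined in turn as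
  -- fresh noise.
  have hYN : Indep (S.observed x v s t) (S.errorNoise x w v s t) μ := by
    have h₁ := h.indep.symm.sup_right_of_sup_left (hY_past.trans hpast) (he_past.trans hpast) hwle
      (indep_of_indep_of_le_left hpast_w (sup_le hY_past he_past))
    exact h₁.sup_right_of_sup_left (hY_past.trans hpast) (sup_le (he_past.trans hpast) hwle) hvle
      (indep_of_indep_of_le_left hpast_v (sup_le (hY_past.trans le_sup_left)
        (sup_le_sup_right he_past _)))
  -- Gaussianity
  have hgw : HasGaussianLaw (w t) μ := (hS.law_w t).hasGaussianLaw
  have hgv : HasGaussianLaw (v t) μ := (hS.law_v t).hasGaussianLaw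
  have hg : HasGaussianLaw (fun ω => ((e ω, w t ω), v t ω)) μ :=
    hewv.hasGaussianLaw (hew.hasGaussianLaw h.gaussian hgw) hgv
  -- The pair must be Gaussian jointly, so it is exhibited as the image of the triple under a single
  -- linear map.
  have hgη : HasGaussianLaw (fun ω => (e' ω, η ω)) μ := by
    let π₁ := (ContinuousLinearMap.fst ℝ (EuclideanSpace ℝ (Fin n)) (EuclideanSpace ℝ (Fin n))).comp
      (ContinuousLinearMap.fst ℝ _ (EuclideanSpace ℝ (Fin p)))
    let π₂ := (ContinuousLinearMap.snd ℝ (EuclideanSpace ℝ (Fin n)) (EuclideanSpace ℝ (Fin n))).comp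
      (ContinuousLinearMap.fst ℝ _ (EuclideanSpace ℝ (Fin p)))
    let π₃ := ContinuousLinearMap.snd ℝ
      (EuclideanSpace ℝ (Fin n) × EuclideanSpace ℝ (Fin n)) (EuclideanSpace ℝ (Fin p))
    let Lη := (LinearMap.toContinuousLinearMap (S.rows s).toEuclideanLin).comp π₁ +
      (restrictCLM s).comp π₃
    let Le := ((LinearMap.toContinuousLinearMap S.A.toEuclideanLin).comp π₁ + π₂) -
      (LinearMap.toContinuousLinearMap K.toEuclideanLin).comp Lη
    rw [he'_eq]
    exact hg.map_fun (Le.prod Lη)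
  -- second moments
  have hme : MemLp e 2 μ := h.gaussian.memLp_two
  have hmw : MemLp (w t) 2 μ := hgw.memLp_two
  have hmη : MemLp η 2 μ := hgη.snd.memLp_two
  have hme' : MemLp e' 2 μ := hgη.fst.memLp_two
  have hmz : MemLp (sensorNoise v s t) 2 μ := (hgv.map (restrictCLM s)).memLp_two
  have hze : IndepFun e (sensorNoise v s t) μ :=
    hewv.comp measurable_fst (restrictCLM s).continuous.measurable
  have hzw : IndepFun (w t) (sensorNoise v s t) μ :=
    hewv.comp measurable_snd (restrictCLM s).continuous.measurable
  have hwe : crossCov μ (w t) e = 0 := crossCov_eq_zero_of_indepFun hmw hme hew.symm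
  have hCew : crossCov μ e (w t) = 0 := crossCov_eq_zero_of_indepFun hme hmw hew
  have hCez : crossCov μ e (sensorNoise v s t) = 0 := crossCov_eq_zero_of_indepFun hme hmz hze
  have hCze : crossCov μ (sensorNoise v s t) e = 0 :=
    crossCov_eq_zero_of_indepFun hmz hme hze.symm
  have hCwz : crossCov μ (w t) (sensorNoise v s t) = 0 :=
    crossCov_eq_zero_of_indepFun hmw hmz hzw
  have hCww : crossCov μ (w t) (w t) = S.σw ^ 2 • 1 :=
    crossCov_eq_of_hasLaw_multivariateGaussian (Matrix.PosSemidef.one.smul (by positivity))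
      (hS.law_w t)
  have hCzz : crossCov μ (sensorNoise v s t) (sensorNoise v s t) = S.σv ^ 2 • 1 := by
    have hv := crossCov_eq_of_hasLaw_multivariateGaussian
      (Matrix.PosSemidef.one.smul (by positivity)) (hS.law_v t)
    ext i j
    exact (congrFun (congrFun hv i) j).trans (by simp [Matrix.one_apply])
  have hPpos : P.PosSemidef := by
    rw [hP, ← h.cov]
    exact crossCov_self_posSemidef hme
  have hCe : MemLp (fun ω => (S.rows s).toEuclideanLin (e ω)) 2 μ := memLp_toEuclideanLin _ hme
  have hAe : MemLp (fun ω => S.A.toEuclideanLin (e ω)) 2 μ := memLp_toEuclideanLin _ hme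
  have hAew : MemLp (fun ω => S.A.toEuclideanLin (e ω) + w t ω) 2 μ := hAe.add hmw
  have hKη : MemLp (fun ω => K.toEuclideanLin (η ω)) 2 μ := memLp_toEuclideanLin _ hmη
  have hCeη : crossCov μ e η = P * (S.rows s).transpose := by
    rw [hη_eq, crossCov_add_right hme hCe hmz, crossCov_toEuclideanLin_right _ hme hme, hCez, h.cov,
      add_zero]
  have hCwη : crossCov μ (w t) η = 0 := by
    rw [hη_eq, crossCov_add_right hmw hCe hmz, crossCov_toEuclideanLin_right _ hmw hme, hCwz, hwe,
      add_zero, Matrix.zero_mul]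
  have hCzη : crossCov μ (sensorNoise v s t) η = S.σv ^ 2 • 1 := by
    rw [hη_eq, crossCov_add_right hmz hCe hmz, crossCov_toEuclideanLin_right _ hmz hme, hCze, hCzz,
      Matrix.zero_mul, zero_add]
  have hCηη : crossCov μ η η =
      S.rows s * P * (S.rows s).transpose + S.σv ^ 2 • (1 : Matrix s s ℝ) := by
    calc crossCov μ η η
        = crossCov μ (fun ω => (S.rows s).toEuclideanLin (e ω) + sensorNoise v s t ω) η := rfl
      _ = _ := by
        rw [crossCov_add_left hCe hmz hmη, crossCov_toEuclideanLin_left _ hme hmη, hCeη, hCzη,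
          Matrix.mul_assoc]
  have hCηe : crossCov μ η e = S.rows s * P := by
    rw [hη_eq, crossCov_add_left hCe hmz hme, crossCov_toEuclideanLin_left _ hme hme, hCze, h.cov,
      add_zero]
  have hCηw : crossCov μ η (w t) = 0 := by
    rw [← crossCov_transpose, hCwη, Matrix.transpose_zero]
  -- Orthogonality: `A e + w` and `K η` have the same cross-covariance with `η`, by the normal
  -- equations `gain_mul`.
  have hCe'η : crossCov μ e' η = 0 := by
    rw [he'_eq, crossCov_sub_left hAew hKη hmη, crossCov_add_left hAe hmw hmη,
      crossCov_toEuclideanLin_left _ hme hmη, crossCov_toEuclideanLin_left _ hmη hmη, hCeη, hCwη,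
      hCηη, hK, S.gain_mul s hσv hPpos, add_zero, Matrix.mul_assoc, sub_self]
  have hCe'e : crossCov μ e' e = S.A * P - K * (S.rows s * P) := by
    rw [he'_eq, crossCov_sub_left hAew hKη hme, crossCov_add_left hAe hmw hme,
      crossCov_toEuclideanLin_left _ hme hme, crossCov_toEuclideanLin_left _ hmη hme, hwe, h.cov,
      hCηe, add_zero]
  have hCe'w : crossCov μ e' (w t) = S.σw ^ 2 • 1 := by
    rw [he'_eq, crossCov_sub_left hAew hKη hmw, crossCov_add_left hAe hmw hmw,
      crossCov_toEuclideanLin_left _ hme hmw, crossCov_toEuclideanLin_left _ hmη hmw, hCww, hCew,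
      hCηw, Matrix.mul_zero, Matrix.mul_zero, zero_add, sub_zero]
  refine ⟨hgη.fst, ?_, ?_, ?_⟩
  · have hw0 : ∫ ω, w t ω ∂μ = 0 := by
      rw [(hS.law_w t).integral_eq]
      exact integral_id_multivariateGaussian
    have hv0 : ∫ ω, v t ω ∂μ = 0 := by
      rw [(hS.law_v t).integral_eq]
      exact integral_id_multivariateGaussian
    have hlin {ι κ : Type} [Fintype ι] [Fintype κ]
        (L : EuclideanSpace ℝ ι →L[ℝ] EuclideanSpace ℝ κ) {X : Ω → EuclideanSpace ℝ ι}
        (hX : Integrable X μ) (h0 : ∫ ω, X ω ∂μ = 0) : ∫ ω, L (X ω) ∂μ = 0 := by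
      rw [L.integral_comp_comm hX, h0, map_zero]
    have hη0 : ∫ ω, η ω ∂μ = 0 := by
      rw [hη_eq, integral_add (hCe.integrable (by norm_num)) (hmz.integrable (by norm_num))]
      have h₁ := hlin (LinearMap.toContinuousLinearMap (S.rows s).toEuclideanLin)
        h.gaussian.integrable h.mean
      have h₂ := hlin (restrictCLM s) hgv.integrable hv0
      exact (congrArg₂ (· + ·) h₁ h₂).trans (add_zero 0)
    have h₁ := hlin (LinearMap.toContinuousLinearMap S.A.toEuclideanLin)
      h.gaussian.integrable h.mean
    have h₂ := hlin (LinearMap.toContinuousLinearMap K.toEuclideanLin)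
      hgη.snd.integrable hη0
    change ∫ ω, e' ω ∂μ = 0
    rw [he'_eq, integral_sub (hAew.integrable (by norm_num)) (hKη.integrable (by norm_num)),
      integral_add (hAe.integrable (by norm_num)) hgw.integrable, hw0, add_zero]
    exact (congrArg₂ (· - ·) h₁ h₂).trans (sub_zero 0)
  -- Only the second `e'` is expanded: its `K η` part drops out by orthogonality, which leaves the
  -- Riccati form with a single gain term.
  · calc crossCov μ e' e'
        = crossCov μ e' (fun ω => (S.A.toEuclideanLin (e ω) + w t ω) - K.toEuclideanLin (η ω)) := by
          rw [← he'_eq]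
      _ = S.riccati s (t + 1) := by
        rw [crossCov_sub_right hme' hAew hKη, crossCov_add_right hme' hAe hmw,
          crossCov_toEuclideanLin_right _ hme' hme, crossCov_toEuclideanLin_right _ hme' hmη,
          hCe'η, hCe'e, hCe'w, riccati, ← hP, ← hK]
        simp only [Matrix.zero_mul, sub_zero, Matrix.sub_mul, Matrix.mul_assoc]
        abel
  · have he'm : Measurable e' := he'N.mono (sup_le (sup_le (he_past.trans hpast) hwle) hvle) le_rfl
    have hηm : Measurable η := hηN.mono (sup_le (sup_le (he_past.trans hpast) hwle) hvle) le_rfl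
    -- `e'` is independent of `η`, and the two together are independent of the earlier outputs;
    -- hence `e'` is independent of `η` and those outputs jointly.
    refine indep_of_indep_of_le_right ?_ (observed_succ_le s t)
    exact Indep.sup_right_of_sup_left he'm.comap_le hηm.comap_le (hY_past.trans hpast)
      (indepFun_of_crossCov_eq_zero hgη hCe'η)
      (indep_of_indep_of_le_left hYN.symm (sup_le he'N.comap_le hηN.comap_le))

theorem isOptimalAt (hS : S.IsRealization μ x w v)
    (hσv : 0 < S.σv) (hP₀ : S.P₀.PosSemidef) (s : Finset (Fin p)) (t : ℕ) :
    S.IsOptimalAt μ x v s t := by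
  induction t with
  | zero => exact hS.isOptimalAt_zero hP₀ s
  | succ t ih => exact hS.isOptimalAt_succ hσv ih

-- The oracle under the zeroing attack

/-- Under the zeroing attack, the oracle estimate is the Kalman estimate from the sensors `s`. -/
theorem oracle_zeroingAttack_ae_eq (hS : S.IsRealization μ x w v)
    (hσv : 0 < S.σv) (hP₀ : S.P₀.PosSemidef) (s : Finset (Fin p))
    (t : ℕ) :
    oracle μ x (S.output x v (S.zeroingAttack x v s)) t =ᵐ[μ] S.kalman s (S.cleanOutput x v) t := by
  have h := hS.isOptimalAt hσv hP₀ s t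
  have hYle : S.observed x v s t ≤ mΩ := (hS.observed_le_past s t).trans (hS.past_le t)
  have hem : Measurable (S.predError x v s t) :=
    (hS.measurable_predError_past s t).mono (hS.past_le t) le_rfl
  have hxg : x t = S.predError x v s t + S.kalman s (S.cleanOutput x v) t := by
    ext1 ω
    simp [predError]
  have hxint : Integrable (x t) μ := hS.integrable_state t
  have hkint : Integrable (S.kalman s (S.cleanOutput x v) t) μ := by
    have : S.kalman s (S.cleanOutput x v) t = x t - S.predError x v s t := by
      rw [hxg, add_sub_cancel_left]
    rw [this]
    exact hxint.sub h.gaussian.integrable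
  -- By independence, conditioning the error on the outputs returns its mean, which is zero.
  have hcond : μ[S.predError x v s t | S.observed x v s t] =ᵐ[μ] fun _ => 0 := by
    have := condExp_indep_eq hem.comap_le hYle
      (comap_measurable (S.predError x v s t)).stronglyMeasurable h.indep
    rwa [h.mean] at this
  have hk : μ[S.kalman s (S.cleanOutput x v) t | S.observed x v s t] =
      S.kalman s (S.cleanOutput x v) t :=
    condExp_of_stronglyMeasurable hYle (measurable_kalman_observed s t).stronglyMeasurable hkint
  change μ[x t | S.observed x v s t] =ᵐ[μ] _
  nth_rw 1 [hxg]
  filter_upwards [condExp_add h.gaussian.integrable hkint (S.observed x v s t), hcond]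
    with ω h₁ h₂
  rw [h₁, Pi.add_apply, h₂, hk, zero_add]

theorem errCov_oracle_zeroingAttack (hS : S.IsRealization μ x w v)
    (hσv : 0 < S.σv) (hP₀ : S.P₀.PosSemidef) (s : Finset (Fin p))
    (t : ℕ) :
    errCov μ (x t) (oracle μ x (S.output x v (S.zeroingAttack x v s)) t) =
      S.kalmanCov μ x v s t := by
  ext i j
  refine integral_congr_ae ?_
  filter_upwards [hS.oracle_zeroingAttack_ae_eq hσv hP₀ s t] with ω h
  rw [h]

end IsRealization

end LinSys

-- The impossibility theorem

theorem theorem1 {n p : ℕ} (S : LinSys n p) (hσw : 0 ≤ S.σw) (hσv : 0 < S.σv)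
    (hP₀ : S.P₀.PosSemidef)
    {Ω : Type*} [MeasurableSpace Ω] (μ : Measure Ω) [IsProbabilityMeasure μ]
    (x w : ℕ → Ω → EuclideanSpace ℝ (Fin n)) (v : ℕ → Ω → EuclideanSpace ℝ (Fin p))
    (hS : S.IsRealization μ x w v)
    (k : ℕ) (hk : k ≤ p)
    -- the steady-state Kalman error covariances of the sensor sets of size `p - k`
    (Pstar : Finset (Fin p) → Matrix (Fin n) (Fin n) ℝ)
    (hPstar : ∀ s : Finset (Fin p), s.card = p - k → S.IsSteadyStateCov μ x v s (Pstar s))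
    -- a worst-case sensor set of size `p - k`
    (sworst : Finset (Fin p)) (hcard : sworst.card = p - k)
    (hworst : ∀ s : Finset (Fin p), s.card = p - k → (Pstar s).trace ≤ (Pstar sworst).trace) :
    ∃ (κ : Finset (Fin p)) (a : ℕ → Ω → EuclideanSpace ℝ (Fin p)),
      S.IsKAttack μ x w v k κ a ∧
      (∀ j ∈ κ, ∀ t ω, S.output x v a t ω j = 0) ∧
      -- the bound at every time at which the worst-case filter is in steady state
      (∀ t, S.kalmanCov μ x v sworst t = Pstar sworst →
        (Pstar sworst).trace ≤
          (LinSys.errCov μ (x t) (LinSys.oracle μ x (S.output x v a) t)).trace) ∧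
      -- the bound in the limit, without that proviso
      (∀ ε > 0, ∀ᶠ t in atTop,
        (Pstar sworst).trace - ε ≤
          (LinSys.errCov μ (x t) (LinSys.oracle μ x (S.output x v a) t)).trace) := by
  refine ⟨sworstᶜ, S.zeroingAttack x v sworst, hS.isKAttack_zeroingAttack hk hcard,
    fun j hj t ω => LinSys.output_zeroingAttack_of_notMem (Finset.mem_compl.mp hj) t ω,
    fun t ht => ?_, fun ε hε => ?_⟩
  · rw [hS.errCov_oracle_zeroingAttack hσv hP₀, ht]
  -- The trace is continuous, so the traces of the filter covariances converge to that of the steady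
  -- state and eventually exceed it minus `ε`.
  · have htr : Tendsto (fun t => (S.kalmanCov μ x v sworst t).trace) atTop
        (𝓝 (Pstar sworst).trace) :=
      ((continuous_id.matrix_trace).tendsto (Pstar sworst)).comp (hPstar sworst hcard)
    filter_upwards [htr.eventually_const_lt (sub_lt_self _ hε)] with t ht
    rw [hS.errCov_oracle_zeroingAttack hσv hP₀]
    exact ht.le
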